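/- **Setting.** On a filtered probability space satisfying the usual conditions, with time interval $[0,1]$, let $X=(X_1,\dots,X_p)$ be log-prices with $$dX(t)=dX^c(t)+L(t)\,d\Lambda(t),\qquad dX^c(t)=\mu(t)\,dt+\sigma^\top(t)\,dW_t,\qquad X^c(0)=X(0),$$ where $W$ is a $q$-dimensional Brownian motion with independent components, $\sigma$ is a $q\times p$ matrix process, the $\Lambda_h$ are Poisson processes with bounded deterministic (time-dependent) intensities and the jump sizes $L_h$ are arbitrary progressively measurable processes. Put $\gamma=\sigma^\top\sigma$ and $\Gamma=\int_0^1\gamma(t)\,dt$. Asset $h$ is observed at finitely many times $t_{h,0}<t_{h,1}<\cdots$ in $[0,1]$ through $X_h(t_{h,l})+\epsilon_h(t_{h,l})$. The noise is centred and square integrable; the vectors $(\epsilon_h(t))_{h\le p}$ are independent for different $t$; for each $h$ the law of $\epsilon_h(t)$ does not depend on $t$; $\mathrm E[\epsilon_h(t)\epsilon_{h'}(t)]=\eta_{hh'}$; and the noise is independent of the prices $(X,X^c)$. Let $0=\tau_0<\tau_1<\dots<\tau_n=1$ be (possibly random) sampling times such that each asset has an observation time in every $(\tau_{k-1},\tau_k]$,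 one of which is selected and denoted $\tau_{h,k}$; all these times are independent of the prices and the noise. Let $g:[0,1]\to\mathbb R$ be continuous and piecewise $C^1$ with piecewise Lipschitz derivative, $g(0)=g(1)=0$, $\int_0^1g^2>0$, and let $K=K_n$ be an integer with $|K_n-C_Kn^{1/2}|\le1$ for a constant $C_K>0$. Put $\phi=K^{-1}\sum_{l=0}^{K-1}g(l/K)^2$ and $\zeta=\sum_{l=0}^{K-1}\{g(l/K)-g((l+1)/K)\}^2$, and for $1\le k\le n-K$ let $$Z_h(\tau_k)=\sum_{l=0}^{K-1}g\Big(\frac lK\Big)\{Y_h(\tau_{h,k+l+1})-Y_h(\tau_{h,k+l})\},\qquad Q_{hh'}(\tau_k)=\frac{n-K}{\phi K}Z_h(\tau_k)Z_{h'}(\tau_k),$$ where $Y_h=X_h+\epsilon_h$. Let $Q^c_{hh'}(\tau_k)$ be the same variable with $Y_h$ replaced by $X^c_h+\epsilon_h$. The target is $$T_{ij}=\Gamma_{ij}+\frac{\#\{1\le k\le n:\tau_{i,k}=\tau_{j,k}\}}{\phi K}\,\zeta\,\eta_{ij}.$$ Given $\alpha_1,\dots,\alpha_p\ge1$ and constants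 $\nu_\mu,\nu_\gamma,\nu_Q>0$ and $C_\Delta\ge1$, let $\Xi$ be the class of all such models with, almost surely, $|\mu_h(t)|\le\nu_\mu$ and $\gamma_{hh}(t)\le\nu_\gamma$ for all $h,t$ and $\max_k(\tau_k-\tau_{k-1})\le C_\Delta/n$, and with $$\mathrm E\big\{|Q^c_{hh}(\tau_k)|^{\alpha_h}\big\}\le\nu_Q\qquad\text{for all }1\le h\le p,\ 1\le k\le n-K.$$ **Theorem.** Let $1\le i,j\le p$ and suppose that $\alpha_{ij}=\min\{2,\,2\alpha_i\alpha_j/(\alpha_i+\alpha_j)\}\in(1,2)$. Let $c>0$. Then there are a constant $C>0$ and an integer $n_0$, depending only on $g,C_K,\alpha_i,\alpha_j,c,\nu_\mu,\nu_\gamma,C_\Delta,\nu_Q$ (not on $p$ or on the other $\alpha_h$), such that for all $n\ge n_0$, all $\delta$ with $\delta^{-1}\in[n^c,e^{n^{1/2}}]$ and every estimator $\widehat T_{ij}=\widehat T_{ij}(Q_{ij}(\tau_1),\dots,Q_{ij}(\tau_{n-K}),\delta)$ (a measurable function of the pre-averaged variables, which may depend on $\delta$), $$\max_{\Xi}\ \Pr\Big\{|\widehat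 T_{ij}-T_{ij}|\ge C\,\big(n^{-1/2}\log\delta^{-1}\big)^{(\alpha_{ij}-1)/\alpha_{ij}}\Big\}\ \ge\ \delta,$$ that is, some model in $\Xi$ makes this probability at least $\delta$. -/

import Mathlib

open MeasureTheory ProbabilityTheory

open scoped unitInterval ENNReal

noncomputable section

namespace PreAveraging

/-! ### Brownian motion, Itô integral and Poisson process on the time interval `[0, 1]`

Time runs through `I = [0, 1]`, which carries Lebesgue measure; `∫ s in Set.Iic t, f s` is
`∫₀ᵗ f(s) ds`. -/

section Processes

variable {Ω : Type} [mΩ : MeasurableSpace Ω]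

/-- The usual conditions: right-continuity, and every `P`-null set belongs to `ℱ 0`
(in particular the probability space is complete). -/
def UsualConditions (P : Measure Ω) (ℱ : Filtration I mΩ) : Prop :=
  ℱ.IsRightContinuous ∧ ∀ s : Set Ω, P s = 0 → MeasurableSet[ℱ 0] s

/-- `W` is a `q`-dimensional Brownian motion with independent components relative to `ℱ`. -/
structure IsBrownianMotion {q : ℕ} (P : Measure Ω) (ℱ : Filtration I mΩ)
    (W : Fin q → I → Ω → ℝ) : Prop where
  adapted : ∀ r t, Measurable[ℱ t] (W r t)
  start : ∀ r, ∀ᵐ ω ∂P, W r 0 ω = 0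
  continuous_paths : ∀ r, ∀ᵐ ω ∂P, Continuous fun t => W r t ω
  law_increment : ∀ s t : I, s ≤ t →
    HasLaw (fun ω r => W r t ω - W r s ω)
      (Measure.pi fun _ : Fin q => gaussianReal 0 (Real.toNNReal ((t : ℝ) - s))) P
  indep_increment : ∀ s t : I, s ≤ t →
    Indep (MeasurableSpace.comap (fun ω (r : Fin q) => W r t ω - W r s ω) inferInstance) (ℱ s) P

/-- A simple integrand `∑_{m < N} ξ_m 1_{(t_m, t_{m+1}]}` with values in `ℝ^q`, where each `ξ_m` is
bounded and `ℱ_{t_m}`-measurable. -/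
structure SimpleIntegrand (q : ℕ) (ℱ : Filtration I mΩ) where
  size : ℕ
  time : ℕ → I
  coeff : ℕ → Fin q → Ω → ℝ
  monotone_time : Monotone time
  measurable_coeff : ∀ m r, Measurable[ℱ (time m)] (coeff m r)
  bounded_coeff : ∃ B : ℝ, ∀ m r ω, |coeff m r ω| ≤ B

namespace SimpleIntegrand

variable {q : ℕ} {ℱ : Filtration I mΩ}

/-- The process defined by a simple integrand. -/
def process (S : SimpleIntegrand q ℱ) (r : Fin q) (s : I) (ω : Ω) : ℝ :=
  ∑ m ∈ Finset.range S.size,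
    (Set.Ioc (S.time m) (S.time (m + 1))).indicator (fun _ => S.coeff m r ω) s

/-- The stochastic integral of a simple integrand over `[0, t]`. -/
def integral (S : SimpleIntegrand q ℱ) (W : Fin q → I → Ω → ℝ) (t : I) (ω : Ω) : ℝ :=
  ∑ m ∈ Finset.range S.size, ∑ r,
    S.coeff m r ω * (W r (min (S.time (m + 1)) t) ω - W r (min (S.time m) t) ω)

end SimpleIntegrand

/-- `M` is a version with continuous paths of the Itô integral `t ↦ ∑_r ∫₀ᵗ H_r dW_r`: there are
simple integrands which converge to `H` in `L²(ds ⊗ P)` and whose integrals over `[0, t]` converge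
to `M t` in `L²(P)`, for every `t`. -/
def IsItoIntegral {q : ℕ} (P : Measure Ω) (ℱ : Filtration I mΩ)
    (W H : Fin q → I → Ω → ℝ) (M : I → Ω → ℝ) : Prop :=
  (∀ᵐ ω ∂P, Continuous fun t => M t ω) ∧
  ∃ S : ℕ → SimpleIntegrand q ℱ,
    Filter.Tendsto
      (fun m => ∫⁻ ω, (∫⁻ s : I, ∑ r, ENNReal.ofReal (((S m).process r s ω - H r s ω) ^ 2)) ∂P)
      Filter.atTop (nhds 0) ∧
    ∀ t : I, Filter.Tendsto
      (fun m => ∫⁻ ω, ENNReal.ofReal (((S m).integral W t ω - M t ω) ^ 2) ∂P)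
      Filter.atTop (nhds 0)

/-- `N` is a Poisson process relative to `ℱ` with (time-dependent) intensity `lam`. -/
structure IsPoissonProcess (P : Measure Ω) (ℱ : Filtration I mΩ) (lam : I → ℝ)
    (N : I → Ω → ℕ) : Prop where
  measurable_intensity : Measurable lam
  intensity_nonneg : ∀ t, 0 ≤ lam t
  adapted : ∀ t, Measurable[ℱ t] (N t)
  start : ∀ᵐ ω ∂P, N 0 ω = 0
  monotone_paths : ∀ᵐ ω ∂P, Monotone fun t => N t ω
  rightContinuous_paths : ∀ᵐ ω ∂P, ∀ t, ContinuousWithinAt (fun u => N u ω) (Set.Ici t) t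
  law_increment : ∀ s t : I, s ≤ t →
    HasLaw (fun ω => N t ω - N s ω)
      (poissonMeasure (Real.toNNReal (∫ u in Set.Ioc s t, lam u))) P
  indep_increment : ∀ s t : I, s ≤ t →
    Indep (MeasurableSpace.comap (fun ω => N t ω - N s ω) inferInstance) (ℱ s) P

/-- The pathwise integral `∫₀ᵗ L dN` against a counting process `N`: the sum over the jump times
`s ∈ (0, t]` of `L(s) (N(s) - N(s-))`. -/
def jumpIntegral (L : I → Ω → ℝ) (N : I → Ω → ℕ) (t : I) (ω : Ω) : ℝ :=
  ∑ᶠ s ∈ Set.Ioc 0 t, L s ω * ((N s ω : ℝ) - Function.leftLim (fun u => (N u ω : ℝ)) s)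

end Processes

/-! ### Pre-averaging -/

/-- The weight functions: continuous and piecewise `C¹` on `[0, 1]` with piecewise Lipschitz
derivative, vanishing at `0` and `1`, and not identically zero. -/
structure IsWeight (g : ℝ → ℝ) : Prop where
  continuousOn : ContinuousOn g (Set.Icc 0 1)
  zero : g 0 = 0
  one : g 1 = 0
  integral_sq_pos : 0 < ∫ t in (0 : ℝ)..1, g t ^ 2
  piecewise : ∃ (m : ℕ) (x : ℕ → ℝ), x 0 = 0 ∧ x m = 1 ∧ (∀ r < m, x r < x (r + 1)) ∧
    ∀ r < m, ∃ (g' : ℝ → ℝ) (B : NNReal),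
      (∀ t ∈ Set.Icc (x r) (x (r + 1)), HasDerivWithinAt g (g' t) (Set.Icc (x r) (x (r + 1))) t) ∧
      LipschitzOnWith B g' (Set.Icc (x r) (x (r + 1)))

/-- `φ = K⁻¹ ∑_{l < K} g(l/K)²`. -/
def phi (g : ℝ → ℝ) (K : ℕ) : ℝ :=
  (1 / (K : ℝ)) * ∑ l ∈ Finset.range K, g ((l : ℝ) / K) ^ 2

/-- `ζ = ∑_{l < K} (g(l/K) - g((l+1)/K))²`. -/
def zeta (g : ℝ → ℝ) (K : ℕ) : ℝ :=
  ∑ l ∈ Finset.range K, (g ((l : ℝ) / K) - g (((l : ℝ) + 1) / K)) ^ 2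

/-- The pre-averaged increments of a sequence `y 1, y 2, …`. -/
def preAverage (g : ℝ → ℝ) (K : ℕ) (y : ℕ → ℝ) (k : ℕ) : ℝ :=
  ∑ l ∈ Finset.range K, g ((l : ℝ) / K) * (y (k + l + 1) - y (k + l))

/-- The quadratic pre-averaged variable of two sequences. -/
def quadPreAverage (g : ℝ → ℝ) (n K : ℕ) (y z : ℕ → ℝ) (k : ℕ) : ℝ :=
  ((n : ℝ) - K) / (phi g K * K) * (preAverage g K y k * preAverage g K z k)

/-- The joint tail index `2 ∧ 2ab / (a + b)` of two assets with tail indices `a` and `b`. -/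
def jointIndex (a b : ℝ) : ℝ := min 2 (2 * a * b / (a + b))

/-! ### The observation model -/

/-- The data of a model for `p` assets with `n` synchronized sampling intervals; the laws that
they obey are stated in `MarketModel.IsJumpDiffusion`, `MarketModel.IsNoise` and
`MarketModel.IsSampling` below. -/
structure MarketModel (p n : ℕ) where
  /-- the probability space -/
  Ω : Type
  mΩ : MeasurableSpace Ω
  P : Measure Ω
  prob : IsProbabilityMeasure P
  /-- the filtration of the price processes -/
  ℱ : Filtration I mΩ
  /-- the dimension of the driving Brownian motion -/
  q : ℕ
  /-- the driving Brownian motion -/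
  W : Fin q → I → Ω → ℝ
  /-- the drift `μ_h(t)` -/
  drift : Fin p → I → Ω → ℝ
  /-- the `q × p` matrix `σ(t)` -/
  vol : Fin q → Fin p → I → Ω → ℝ
  /-- the jump sizes `L_h(t)` -/
  jumpSize : Fin p → I → Ω → ℝ
  /-- the intensities of the Poisson processes -/
  intensity : Fin p → I → ℝ
  /-- the Poisson processes `Λ_h(t)` -/
  poisson : Fin p → I → Ω → ℕ
  /-- the continuous log-prices `X_h^c(t)` -/
  Xc : Fin p → I → Ω → ℝ
  /-- the log-prices `X_h(t)` -/
  X : Fin p → I → Ω → ℝ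
  /-- the noise `ε_h(t)` that contaminates an observation of asset `h` at time `t` -/
  noise : Fin p → I → Ω → ℝ
  /-- the noise covariances `η_{hh'}` -/
  η : Fin p → Fin p → ℝ
  /-- asset `h` is observed `numObs h + 1` times -/
  numObs : Fin p → ℕ
  /-- the observation times `t_{h,l}`, `0 ≤ l ≤ numObs h` -/
  obsTime : Fin p → ℕ → Ω → I
  /-- the generalized sampling times `τ_k`, `0 ≤ k ≤ n` -/
  τ : ℕ → Ω → I
  /-- the selected observation times `τ_{h,k} ∈ (τ_{k-1}, τ_k]`, `1 ≤ k ≤ n` -/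
  selTime : Fin p → ℕ → Ω → I

attribute [instance] MarketModel.mΩ MarketModel.prob

namespace MarketModel

variable {p n : ℕ}

/-- The instantaneous covolatility `γ_{hh'}(t) = (σᵀ(t) σ(t))_{hh'}`. -/
def γ (m : MarketModel p n) (h h' : Fin p) (t : I) (ω : m.Ω) : ℝ :=
  ∑ r, m.vol r h t ω * m.vol r h' t ω

/-- The integrated covolatility `Γ_{hh'} = ∫₀¹ γ_{hh'}(t) dt`. -/
def Γ (m : MarketModel p n) (h h' : Fin p) (ω : m.Ω) : ℝ :=
  ∫ t : I, m.γ h h' t ω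

/-- The jump-diffusion model `dX = dX^c + L dΛ`, `dX^c = μ dt + σᵀ dW`, `X^c(0) = X(0)`. -/
structure IsJumpDiffusion (m : MarketModel p n) : Prop where
  usual : UsualConditions m.P m.ℱ
  brownian : IsBrownianMotion m.P m.ℱ m.W
  progressive_drift : ∀ h, IsProgressive m.ℱ (m.drift h)
  progressive_vol : ∀ r h, IsProgressive m.ℱ (m.vol r h)
  progressive_jumpSize : ∀ h, IsProgressive m.ℱ (m.jumpSize h)
  poisson : ∀ h, IsPoissonProcess m.P m.ℱ (m.intensity h) (m.poisson h)
  bounded_intensity : ∃ B : ℝ, ∀ h t, m.intensity h t ≤ B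
  adapted_Xc : ∀ h t, Measurable[m.ℱ t] (m.Xc h t)
  adapted_X : ∀ h t, Measurable[m.ℱ t] (m.X h t)
  continuous_part : ∀ h, IsItoIntegral m.P m.ℱ m.W (fun r => m.vol r h)
    (fun t ω => m.Xc h t ω - m.Xc h 0 ω - ∫ s in Set.Iic t, m.drift h s ω)
  jump_part : ∀ h, ∀ᵐ ω ∂m.P, ∀ t,
    m.X h t ω = m.Xc h t ω + jumpIntegral (m.jumpSize h) (m.poisson h) t ω

/-- The σ-algebra generated by the price processes `X` and `X^c`. -/
@[reducible] def priceSigma (m : MarketModel p n) : MeasurableSpace m.Ω :=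
  ⨆ (h : Fin p) (t : I),
    MeasurableSpace.comap (m.X h t) inferInstance ⊔ MeasurableSpace.comap (m.Xc h t) inferInstance

/-- The σ-algebra generated by the noise. -/
@[reducible] def noiseSigma (m : MarketModel p n) : MeasurableSpace m.Ω :=
  ⨆ (h : Fin p) (t : I), MeasurableSpace.comap (m.noise h t) inferInstance

/-- The σ-algebra generated by all sampling and observation times. -/
@[reducible] def timeSigma (m : MarketModel p n) : MeasurableSpace m.Ω :=
  (⨆ k : Set.Iic n, MeasurableSpace.comap (m.τ k) inferInstance) ⊔
  (⨆ (h : Fin p) (l : Set.Iic (m.numObs h)),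
    MeasurableSpace.comap (m.obsTime h l) inferInstance) ⊔
  (⨆ (h : Fin p) (k : Set.Icc 1 n), MeasurableSpace.comap (m.selTime h k) inferInstance)

/-- The microstructural noise: centred, square-integrable, independent over time with a law that
does not change over time, with cross-sectional covariances `η`, independent of the prices. The
last field says that the noise in each actual observation is a random variable. -/
structure IsNoise (m : MarketModel p n) : Prop where
  measurable : ∀ h t, Measurable (m.noise h t)
  memLp : ∀ h t, MemLp (m.noise h t) 2 m.P
  mean_zero : ∀ h t, ∫ ω, m.noise h t ω ∂m.P = 0
  covariance : ∀ h h' t, ∫ ω, m.noise h t ω * m.noise h' t ω ∂m.P = m.η h h'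
  identDistrib : ∀ h s t, IdentDistrib (m.noise h s) (m.noise h t) m.P m.P
  indep_times : iIndepFun (fun (t : I) (ω : m.Ω) (h : Fin p) => m.noise h t ω) m.P
  indep_price : Indep m.noiseSigma m.priceSigma m.P
  measurable_obs : ∀ h, ∀ l ≤ m.numObs h, Measurable fun ω => m.noise h (m.obsTime h l ω) ω

/-- Generalized sampling times: `0 = τ_0 < ⋯ < τ_n = 1`, every asset is observed in every
`(τ_{k-1}, τ_k]`, and `τ_{h,k}` is one of its observation times there. The times are independent
of the prices and the noise. -/
structure IsSampling (m : MarketModel p n) : Prop where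
  measurable_τ : ∀ k ≤ n, Measurable (m.τ k)
  measurable_obsTime : ∀ h, ∀ l ≤ m.numObs h, Measurable (m.obsTime h l)
  measurable_selTime : ∀ h, ∀ k ∈ Set.Icc 1 n, Measurable (m.selTime h k)
  τ_zero : ∀ ω, m.τ 0 ω = 0
  τ_last : ∀ ω, m.τ n ω = 1
  τ_lt : ∀ ω, ∀ k < n, m.τ k ω < m.τ (k + 1) ω
  obsTime_lt : ∀ ω h, ∀ l < m.numObs h, m.obsTime h l ω < m.obsTime h (l + 1) ω
  selTime_mem : ∀ ω h, ∀ k < n, m.selTime h (k + 1) ω ∈ Set.Ioc (m.τ k ω) (m.τ (k + 1) ω)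
  selTime_obs : ∀ ω h, ∀ k < n, ∃ l ≤ m.numObs h, m.selTime h (k + 1) ω = m.obsTime h l ω
  indep : Indep m.timeSigma (m.priceSigma ⊔ m.noiseSigma) m.P

/-- The observed synchronized log-price `Y_h(τ_{h,k})`. -/
def Y (m : MarketModel p n) (h : Fin p) (ω : m.Ω) (k : ℕ) : ℝ :=
  m.X h (m.selTime h k ω) ω + m.noise h (m.selTime h k ω) ω

/-- Its continuous part `Y_h^c(τ_{h,k})`. -/
def Yc (m : MarketModel p n) (h : Fin p) (ω : m.Ω) (k : ℕ) : ℝ :=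
  m.Xc h (m.selTime h k ω) ω + m.noise h (m.selTime h k ω) ω

/-- The quadratic pre-averaged variable `Q_{hh'}(τ_k)`. -/
def Q (m : MarketModel p n) (g : ℝ → ℝ) (K : ℕ) (h h' : Fin p) (k : ℕ) (ω : m.Ω) : ℝ :=
  quadPreAverage g n K (m.Y h ω) (m.Y h' ω) k

/-- Its continuous part `Q_{hh'}^c(τ_k)`. -/
def Qc (m : MarketModel p n) (g : ℝ → ℝ) (K : ℕ) (h h' : Fin p) (k : ℕ) (ω : m.Ω) : ℝ :=
  quadPreAverage g n K (m.Yc h ω) (m.Yc h' ω) k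

/-- `ρ_{hh'} = #{1 ≤ k ≤ n : τ_{h,k} = τ_{h',k}} ζ η_{hh'} / (φ K)`. -/
def ρ (m : MarketModel p n) (g : ℝ → ℝ) (K : ℕ) (h h' : Fin p) (ω : m.Ω) : ℝ :=
  (∑ k ∈ Finset.Icc 1 n, if m.selTime h k ω = m.selTime h' k ω then (1 : ℝ) else 0)
    / (phi g K * K) * zeta g K * m.η h h'

/-- The target `T_{hh'} = Γ_{hh'} + ρ_{hh'}`. -/
def T (m : MarketModel p n) (g : ℝ → ℝ) (K : ℕ) (h h' : Fin p) (ω : m.Ω) : ℝ :=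
  m.Γ h h' ω + m.ρ g K h h' ω

/-- The class of admissible models: drift and spot volatilities are bounded by `νμ` and `νγ`,
sampling intervals by `CΔ / n`, and the moments of order `α_h` of `Q_{hh}^c(τ_k)` by `νQ`. -/
structure IsAdmissible (m : MarketModel p n) (g : ℝ → ℝ) (K : ℕ) (α : Fin p → ℝ)
    (νμ νγ CΔ νQ : ℝ) : Prop where
  jumpDiffusion : m.IsJumpDiffusion
  noise : m.IsNoise
  sampling : m.IsSampling
  drift_le : ∀ᵐ ω ∂m.P, ∀ h t, |m.drift h t ω| ≤ νμ
  vol_le : ∀ᵐ ω ∂m.P, ∀ h t, m.γ h h t ω ≤ νγ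
  interval_le : ∀ᵐ ω ∂m.P, ∀ k < n, (m.τ (k + 1) ω : ℝ) - m.τ k ω ≤ CΔ / n
  moment_le : ∀ h, ∀ k ∈ Set.Icc 1 (n - K),
    ∫⁻ ω, ENNReal.ofReal (|m.Qc g K h h k ω| ^ α h) ∂m.P ≤ ENNReal.ofReal νQ

end MarketModel

end PreAveraging

end

/-! The difficulty sits entirely in the noise part of the target. Take all prices to be zero and let
the noise of asset `h` at time `t` be `M_h ξ_t`, where the i.i.d. `ξ_t` are `±1` with total
probability `θ = log δ⁻¹ / (2n)` and `0` otherwise. With probability `(1 - θ)^n ≥ δ` no observation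
is contaminated. Then every pre-averaged variable is `0` and the estimator returns the same number
as in the model without noise, whereas the targets of the two models differ by a multiple of `η_ij =
M_i M_j θ`. Whatever that number is, it is wrong in one of the two models by half the difference.

It remains to take `M` as large as the moment conditions allow. Put `r = n^{-1/2} log δ⁻¹`. A window
of `K ≍ √n` observations is contaminated with probability of order at most `r`, and then `Q_hh` is
at most of order `M_h² / √n` times the squared number of contaminations. So `M_h² ≍ √n r^{-1/α_h}`
keeps the moment of order `α_h` bounded, and `M_i M_j θ` is of order `r^{1 - 1/(2α_i) - 1/(2α_j)}`,
which is the claimed rate.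

The admissibility of this choice rests on `lintegral_count_rpow_le`, `noiseModel_moment_le` and
`moment_bound`, the separation of the targets on `le_target_coeff` and `noiseScale_mul`, and the
two-model comparison is `exists_noiseModel_error_ge`. -/

noncomputable section

namespace PreAveraging

/-! ### Weight functions -/

section Weight

variable {g : ℝ → ℝ}

/-- A weight function is Lipschitz on `[0, 1]`. -/
lemma IsWeight.exists_lipschitz (hg : IsWeight g) :
    ∃ B : ℝ, 0 < B ∧ ∀ s ∈ Set.Icc (0 : ℝ) 1, ∀ t ∈ Set.Icc (0 : ℝ) 1,
      |g t - g s| ≤ B * |t - s| := by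
  obtain ⟨m, x, hx0, hxm, hlt, hd⟩ := hg.piecewise
  have piece : ∀ r < m, ∃ B : ℝ, 0 ≤ B ∧ ∀ s ∈ Set.Icc (x r) (x (r + 1)),
      ∀ t ∈ Set.Icc (x r) (x (r + 1)), |g t - g s| ≤ B * |t - s| := by
    intro r hr
    obtain ⟨g', L, hg', hL⟩ := hd r hr
    obtain ⟨B, hB⟩ := isCompact_Icc.exists_bound_of_continuousOn hL.continuousOn
    refine ⟨B, (norm_nonneg _).trans (hB (x r) ⟨le_rfl, (hlt r hr).le⟩), fun s hs t ht => ?_⟩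
    exact (convex_Icc _ _).norm_image_sub_le_of_norm_hasDerivWithin_le hg' hB hs ht
  -- Glue the pieces by induction on the breakpoints: an increment across `x r` splits there, and
  -- the larger of the two constants serves.
  have main : ∀ r ≤ m, ∃ B : ℝ, 0 ≤ B ∧ 0 ≤ x r ∧ ∀ s ∈ Set.Icc 0 (x r),
      ∀ t ∈ Set.Icc 0 (x r), s ≤ t → |g t - g s| ≤ B * (t - s) := by
    intro r
    induction r with
    | zero =>
      intro _
      refine ⟨0, le_rfl, hx0.ge, fun s hs t ht _ => ?_⟩
      rw [hx0] at hs ht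
      have hs' : s = 0 := le_antisymm hs.2 hs.1
      have ht' : t = 0 := le_antisymm ht.2 ht.1
      simp [hs', ht']
    | succ r ih =>
      intro hr
      obtain ⟨B₁, hB₁, hxr, h₁⟩ := ih (by omega)
      obtain ⟨B₂, hB₂, h₂⟩ := piece r (by omega)
      have hlt' := hlt r (by omega)
      have m₁ : B₁ ≤ max B₁ B₂ := le_max_left _ _
      have m₂ : B₂ ≤ max B₁ B₂ := le_max_right _ _
      refine ⟨max B₁ B₂, hB₁.trans m₁, by linarith, fun s hs t ht hst => ?_⟩
      rcases le_total t (x r) with htr | htr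
      · exact (h₁ s ⟨hs.1, hst.trans htr⟩ t ⟨ht.1, htr⟩ hst).trans
          (mul_le_mul_of_nonneg_right m₁ (by linarith))
      rcases le_total s (x r) with hsr | hsr
      · have e₁ := h₁ s ⟨hs.1, hsr⟩ (x r) ⟨hxr, le_rfl⟩ hsr
        have e₂ := h₂ (x r) ⟨le_rfl, hlt'.le⟩ t ⟨htr, ht.2⟩
        rw [abs_of_nonneg (sub_nonneg.2 htr)] at e₂
        have e₃ := abs_sub_le (g t) (g (x r)) (g s)
        have e₄ := mul_le_mul_of_nonneg_right m₁ (sub_nonneg.2 hsr)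
        have e₅ := mul_le_mul_of_nonneg_right m₂ (sub_nonneg.2 htr)
        linarith
      · have e₂ := h₂ s ⟨hsr, hs.2⟩ t ⟨htr, ht.2⟩
        rw [abs_of_nonneg (sub_nonneg.2 hst)] at e₂
        exact e₂.trans (mul_le_mul_of_nonneg_right m₂ (by linarith))
  obtain ⟨B, hB, -, h⟩ := main m le_rfl
  rw [hxm] at h
  refine ⟨B + 1, by linarith, fun s hs t ht => ?_⟩
  refine le_trans ?_ (mul_le_mul_of_nonneg_right (le_add_of_nonneg_right zero_le_one :
    B ≤ B + 1) (abs_nonneg _))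
  rcases le_total s t with hst | hst
  · rw [abs_of_nonneg (sub_nonneg.2 hst)]
    exact h s hs t ht hst
  · rw [abs_sub_comm, abs_sub_comm t, abs_of_nonneg (sub_nonneg.2 hst)]
    exact h t ht s hs hst

lemma div_mem_Icc_zero_one {l K : ℕ} (hl : l ≤ K) : (l : ℝ) / K ∈ Set.Icc (0 : ℝ) 1 :=
  ⟨by positivity, div_le_one_of_le₀ (by exact_mod_cast hl) (by positivity)⟩

lemma abs_sub_grid_le {B : ℝ}
    (hB : ∀ s ∈ Set.Icc (0 : ℝ) 1, ∀ t ∈ Set.Icc (0 : ℝ) 1, |g t - g s| ≤ B * |t - s|)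
    {l K : ℕ} (hl : l < K) :
    |g ((l : ℝ) / K) - g (((l : ℝ) + 1) / K)| ≤ B / K := by
  have hK : (0 : ℝ) < K := by exact_mod_cast (by omega : 0 < K)
  have h := hB _ (div_mem_Icc_zero_one hl.le) _ (div_mem_Icc_zero_one (Nat.succ_le_of_lt hl))
  rw [abs_sub_comm]
  push_cast at h
  rwa [← sub_div, add_sub_cancel_left, abs_of_pos (one_div_pos.2 hK), mul_one_div] at h

/-- The Riemann sum `φ` controls the integral of `g²` from above. -/
lemma integral_sq_le_phi (hg : ContinuousOn g (Set.Icc 0 1)) {B : ℝ} (hB0 : 0 ≤ B)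
    (hB : ∀ s ∈ Set.Icc (0 : ℝ) 1, ∀ t ∈ Set.Icc (0 : ℝ) 1, |g t - g s| ≤ B * |t - s|)
    {K : ℕ} (hK : 0 < K) :
    ∫ t in (0 : ℝ)..1, g t ^ 2 ≤ 2 * phi g K + 2 * (B / K) ^ 2 := by
  have hK' : (0 : ℝ) < K := by exact_mod_cast hK
  have hmono : ∀ l : ℕ, (l : ℝ) / K ≤ ((l + 1 : ℕ) : ℝ) / K := fun l => by
    gcongr; exact_mod_cast Nat.le_succ l
  have hint : ∀ l < K, IntervalIntegrable (fun t => g t ^ 2) volume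
      ((l : ℝ) / K) (((l + 1 : ℕ) : ℝ) / K) := fun l hl => by
    refine ContinuousOn.intervalIntegrable ((hg.pow 2).mono ?_)
    rw [Set.uIcc_of_le (hmono l)]
    exact Set.Icc_subset_Icc (div_mem_Icc_zero_one hl.le).1
      (div_mem_Icc_zero_one (Nat.succ_le_of_lt hl)).2
  have hsum := intervalIntegral.sum_integral_adjacent_intervals hint
  rw [Nat.cast_zero, zero_div, div_self hK'.ne'] at hsum
  rw [← hsum]
  have hterm : ∀ l ∈ Finset.range K,
      ∫ t in ((l : ℝ) / K)..(((l + 1 : ℕ) : ℝ) / K), g t ^ 2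
        ≤ (2 * g ((l : ℝ) / K) ^ 2 + 2 * (B / K) ^ 2) * (1 / K) := by
    intro l hl
    have hl' := Finset.mem_range.1 hl
    have hlen : ((l + 1 : ℕ) : ℝ) / K - (l : ℝ) / K = 1 / K := by
      push_cast; rw [← sub_div, add_sub_cancel_left]
    calc ∫ t in ((l : ℝ) / K)..(((l + 1 : ℕ) : ℝ) / K), g t ^ 2
        ≤ ∫ t in ((l : ℝ) / K)..(((l + 1 : ℕ) : ℝ) / K),
            (2 * g ((l : ℝ) / K) ^ 2 + 2 * (B / K) ^ 2) := by
          refine intervalIntegral.integral_mono_on (hmono l) (hint l hl') (by simp) ?_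
          intro t ht
          have ht01 : t ∈ Set.Icc (0 : ℝ) 1 := Set.Icc_subset_Icc (div_mem_Icc_zero_one hl'.le).1
            (div_mem_Icc_zero_one (Nat.succ_le_of_lt hl')).2 ht
          have h := hB _ (div_mem_Icc_zero_one hl'.le) _ ht01
          have h' : |t - (l : ℝ) / K| ≤ 1 / K := by
            rw [abs_of_nonneg (sub_nonneg.2 ht.1), ← hlen]
            linarith [ht.2]
          have h'' : |g t - g ((l : ℝ) / K)| ≤ B / K :=
            h.trans ((mul_le_mul_of_nonneg_left h' hB0).trans_eq (mul_one_div _ _))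
          have h3 : (g t - g ((l : ℝ) / K)) ^ 2 ≤ (B / K) ^ 2 :=
            sq_le_sq' (abs_le.1 h'').1 (abs_le.1 h'').2
          -- With `u = g (l/K)`, the slack in `g t ^ 2 ≤ 2u² + 2(g t - u)²` is exactly `(g t -
          -- 2u)²`.
          nlinarith [sq_nonneg (g t - 2 * g ((l : ℝ) / K))]
      _ = _ := by rw [intervalIntegral.integral_const, hlen, smul_eq_mul, mul_comm]
  refine (Finset.sum_le_sum hterm).trans_eq ?_
  rw [← Finset.sum_mul, Finset.sum_add_distrib, ← Finset.mul_sum, phi, Finset.sum_const,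
    Finset.card_range, nsmul_eq_mul]
  field_simp

/-- A discrete Poincaré inequality. -/
lemma phi_le_mul_zeta (h0 : g 0 = 0) (K : ℕ) : phi g K ≤ K * zeta g K := by
  rcases Nat.eq_zero_or_pos K with rfl | hK
  · simp [phi]
  have hK' : (0 : ℝ) < K := by exact_mod_cast hK
  have key : ∀ l ∈ Finset.range K, g ((l : ℝ) / K) ^ 2 ≤ K * zeta g K := by
    intro l hl
    have hl' := (Finset.mem_range.1 hl).le
    -- Telescope from `g 0 = 0`, then apply Cauchy–Schwarz to at most `K` increments.
    have tele : g ((l : ℝ) / K)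
        = ∑ r ∈ Finset.range l, (g (((r : ℝ) + 1) / K) - g ((r : ℝ) / K)) := by
      have := Finset.sum_range_sub (fun r : ℕ => g ((r : ℝ) / K)) l
      push_cast at this
      rw [this]; simp [h0]
    rw [tele]
    refine sq_sum_le_card_mul_sum_sq.trans ?_
    rw [Finset.card_range]
    refine mul_le_mul (by exact_mod_cast hl') ?_ (Finset.sum_nonneg fun _ _ => sq_nonneg _) hK'.le
    refine (Finset.sum_le_sum_of_subset_of_nonneg (Finset.range_mono hl')
      fun _ _ _ => sq_nonneg _).trans_eq ?_
    exact Finset.sum_congr rfl fun r _ => by ring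
  calc phi g K ≤ 1 / K * ∑ _l ∈ Finset.range K, (K * zeta g K) :=
        mul_le_mul_of_nonneg_left (Finset.sum_le_sum key) (by positivity)
    _ = K * zeta g K := by
        rw [Finset.sum_const, Finset.card_range, nsmul_eq_mul]; field_simp

/-- Summation by parts: pre-averaging weights the observations by the increments of `g`. -/
lemma preAverage_eq_sum (h0 : g 0 = 0) (h1 : g 1 = 0) {K : ℕ} (hK : 0 < K) (y : ℕ → ℝ) (k : ℕ) :
    preAverage g K y k
      = ∑ l ∈ Finset.range K, (g ((l : ℝ) / K) - g (((l : ℝ) + 1) / K)) * y (k + l + 1) := by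
  have hK' : (K : ℝ) ≠ 0 := by exact_mod_cast hK.ne'
  -- Both boundary terms of this telescoping sum vanish because `g 0 = g 1 = 0`.
  have := Finset.sum_range_sub (fun l : ℕ => g ((l : ℝ) / K) * y (k + l)) K
  simp only [Nat.cast_zero, zero_div, h0, div_self hK', h1, zero_mul, sub_zero] at this
  rw [preAverage, ← sub_eq_zero, ← Finset.sum_sub_distrib, ← this]
  refine Finset.sum_congr rfl fun l _ => ?_
  push_cast
  rw [← add_assoc]
  ring

/-- After summation by parts the weights are increments of `g` over cells of length `1/K`. So a few
contaminated observations move a window only by a multiple of `1/K`. -/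
lemma abs_preAverage_le (h0 : g 0 = 0) (h1 : g 1 = 0) {B : ℝ}
    (hB : ∀ s ∈ Set.Icc (0 : ℝ) 1, ∀ t ∈ Set.Icc (0 : ℝ) 1, |g t - g s| ≤ B * |t - s|)
    {K : ℕ} (hK : 0 < K) (y : ℕ → ℝ) (k : ℕ) :
    |preAverage g K y k| ≤ B / K * ∑ l ∈ Finset.range K, |y (k + l + 1)| := by
  rw [preAverage_eq_sum h0 h1 hK, Finset.mul_sum]
  refine (Finset.abs_sum_le_sum_abs _ _).trans (Finset.sum_le_sum fun l hl => ?_)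
  rw [abs_mul]
  exact mul_le_mul_of_nonneg_right (abs_sub_grid_le hB (Finset.mem_range.1 hl)) (abs_nonneg _)

end Weight

/-! ### Sparse symmetric noise -/

/-- The law of a variable that equals `1` and `-1` with probability `θ / 2` each, and `0`
otherwise. -/
def sparseSign (θ : ℝ) : Measure ℝ :=
  ENNReal.ofReal (1 - θ) • Measure.dirac 0 +
    ENNReal.ofReal (θ / 2) • (Measure.dirac 1 + Measure.dirac (-1))

section SparseSign

variable {θ : ℝ}

lemma isProbabilityMeasure_sparseSign (h0 : 0 ≤ θ) (h1 : θ ≤ 1) :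
    IsProbabilityMeasure (sparseSign θ) := by
  constructor
  simp only [sparseSign, Measure.add_apply, Measure.smul_apply, measure_univ, smul_eq_mul]
  rw [one_add_one_eq_two, ← ENNReal.ofReal_ofNat, mul_one, ← ENNReal.ofReal_mul (by linarith),
    ← ENNReal.ofReal_add (by linarith) (by linarith)]
  norm_num

lemma sparseSign_singleton_zero : sparseSign θ {0} = ENNReal.ofReal (1 - θ) := by
  simp [sparseSign]

lemma lintegral_sparseSign (f : ℝ → ℝ≥0∞) :
    ∫⁻ x, f x ∂sparseSign θ
      = ENNReal.ofReal (1 - θ) * f 0 + ENNReal.ofReal (θ / 2) * (f 1 + f (-1)) := by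
  simp [sparseSign, lintegral_add_measure, lintegral_smul_measure, mul_add]

lemma integral_sparseSign (h0 : 0 ≤ θ) (h1 : θ ≤ 1) (f : ℝ → ℝ) :
    ∫ x, f x ∂sparseSign θ = (1 - θ) * f 0 + θ / 2 * (f 1 + f (-1)) := by
  have hd : ∀ x : ℝ, Integrable f (Measure.dirac x) := fun x => integrable_dirac (by simp)
  rw [sparseSign, integral_add_measure ((hd 0).smul_measure ENNReal.ofReal_ne_top)
    (((hd 1).add_measure (hd (-1))).smul_measure ENNReal.ofReal_ne_top),
    integral_smul_measure, integral_smul_measure, integral_add_measure (hd 1) (hd (-1))]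
  simp only [integral_dirac, smul_eq_mul]
  rw [ENNReal.toReal_ofReal (by linarith), ENNReal.toReal_ofReal (by linarith)]

lemma ae_abs_le_one_sparseSign : ∀ᵐ x ∂sparseSign θ, |x| ≤ 1 := by
  have hs : MeasurableSet {x : ℝ | |x| ≤ 1} := measurableSet_le (by fun_prop) (by fun_prop)
  rw [ae_iff]
  change sparseSign θ {x : ℝ | |x| ≤ 1}ᶜ = 0
  simp [sparseSign, Measure.dirac_apply' _ hs.compl]

end SparseSign

/-- Completion does not affect the law of a random variable. -/
lemma map_completion {Ω β : Type*} {mΩ : MeasurableSpace Ω} {mβ : MeasurableSpace β}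
    (μ : Measure Ω) {f : Ω → β} (hf : Measurable f) :
    @Measure.map (NullMeasurableSpace Ω μ) β _ _ f μ.completion = μ.map f := by
  have hf' : @Measurable (NullMeasurableSpace Ω μ) β _ _ f :=
    fun s hs => (hf hs).nullMeasurableSet
  ext s hs
  rw [Measure.map_apply hf' hs, Measure.map_apply hf hs]
  exact Measure.completion_apply μ _

/-- An independent family with a given common law on a complete probability space. -/
lemma exists_iid_isComplete (ι : Type) (ν : Measure ℝ) [IsProbabilityMeasure ν] :
    ∃ (Ω : Type) (_ : MeasurableSpace Ω) (P : Measure Ω) (ξ : ι → Ω → ℝ),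
      IsProbabilityMeasure P ∧ P.IsComplete ∧ (∀ t, Measurable (ξ t)) ∧
      (∀ t, P.map (ξ t) = ν) ∧ iIndepFun ξ P := by
  let μ : Measure (ι → ℝ) := Measure.infinitePi fun _ => ν
  have hind : iIndepFun (fun (t : ι) (ω : ι → ℝ) => ω t) μ :=
    iIndepFun_infinitePi (P := fun _ : ι => ν) (X := fun _ x => x) fun _ => measurable_id
  -- The product measure is completed because the usual conditions require null sets to be
  -- measurable.
  refine ⟨NullMeasurableSpace (ι → ℝ) μ, inferInstance, μ.completion, fun t ω => ω t, ⟨?_⟩,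
    inferInstance, fun t s hs => ?_, fun t => ?_, ?_⟩
  · exact measure_univ (μ := μ)
  · exact (measurable_pi_apply t hs).nullMeasurableSet
  · exact (map_completion μ (measurable_pi_apply t)).trans
      (Measure.infinitePi_map_eval (fun _ : ι => ν) t)
  · rw [iIndepFun_iff_measure_inter_preimage_eq_mul] at hind ⊢
    exact hind

/-! ### The number of non-zero variables -/

/-- Exponential growth beats powers, by Bernoulli's inequality. The `- 1` makes the right side
vanish at `N = 0`, so that its expectation is small when contamination is rare. -/
lemma rpow_le_two_pow_sub_one {s : ℝ} (hs : 0 < s) (N : ℕ) :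
    (N : ℝ) ^ s ≤ 2 * s ^ s * (2 ^ N - 1) := by
  rcases Nat.eq_zero_or_pos N with rfl | hN
  · simp [Real.zero_rpow hs.ne']
  have h1 : (N : ℝ) / s ≤ (2 : ℝ) ^ ((N : ℝ) / s) := by
    rcases le_total ((N : ℝ) / s) 1 with h | h
    · exact h.trans (Real.one_le_rpow one_le_two (by positivity))
    · have := one_add_mul_self_le_rpow_one_add (s := 1) (by norm_num) h
      norm_num at this
      linarith
  have h2 : (N : ℝ) ^ s ≤ s ^ s * 2 ^ N := by
    calc (N : ℝ) ^ s = s ^ s * ((N : ℝ) / s) ^ s := by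
          rw [← Real.mul_rpow hs.le (by positivity), mul_div_cancel₀ _ hs.ne']
      _ ≤ s ^ s * ((2 : ℝ) ^ ((N : ℝ) / s)) ^ s := by gcongr
      _ = s ^ s * 2 ^ N := by
          rw [← Real.rpow_mul (by norm_num), div_mul_cancel₀ _ hs.ne', Real.rpow_natCast]
  have h3 : (2 : ℝ) ≤ 2 ^ N := by
    simpa using pow_le_pow_right₀ (by norm_num : (1 : ℝ) ≤ 2) hN
  have h4 : 0 < s ^ s := Real.rpow_pos_of_pos hs s
  nlinarith

section Count

variable {Ω ι : Type*} [mΩ : MeasurableSpace Ω] {P : Measure Ω}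
  {θ : ℝ} {ξ : ι → Ω → ℝ}

lemma measurable_ite_ne_zero {β : Type*} [MeasurableSpace β] (u v : β) :
    Measurable fun x : ℝ => if x ≠ 0 then u else v :=
  Measurable.ite (measurableSet_singleton 0).compl measurable_const measurable_const

/-- The probability that finitely many of the variables all vanish. -/
lemma measure_forall_eq_zero (hm : ∀ t, Measurable (ξ t))
    (hlaw : ∀ t, P.map (ξ t) = sparseSign θ) (hind : iIndepFun ξ P) (S : Finset ι) :
    P {ω | ∀ t ∈ S, ξ t ω = 0} = ENNReal.ofReal (1 - θ) ^ S.card := by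
  have h := hind.measure_inter_preimage_eq_mul S (sets := fun _ => {0})
    fun _ _ => measurableSet_singleton 0
  have hset : {ω | ∀ t ∈ S, ξ t ω = 0} = ⋂ t ∈ S, ξ t ⁻¹' {0} := by
    ext ω; simp
  rw [hset, h, Finset.prod_congr rfl fun t _ => ?_, Finset.prod_const]
  rw [← Measure.map_apply (hm t) (measurableSet_singleton 0), hlaw, sparseSign_singleton_zero]

/-- The moments of the number of non-zero variables among finitely many. -/
lemma lintegral_count_rpow_le [IsProbabilityMeasure P] (h0 : 0 ≤ θ) (h1 : θ ≤ 1) (hm : ∀ t, Measurable (ξ t))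
    (hlaw : ∀ t, P.map (ξ t) = sparseSign θ) (hind : iIndepFun ξ P) (S : Finset ι)
    {s : ℝ} (hs : 0 < s) :
    ∫⁻ ω, ENNReal.ofReal ((∑ t ∈ S, if ξ t ω ≠ 0 then (1 : ℝ) else 0) ^ s) ∂P
      ≤ ENNReal.ofReal (2 * s ^ s * (S.card * θ * Real.exp (S.card * θ))) := by
  have hA : 0 ≤ 2 * s ^ s := by positivity
  -- `F` is `2` to the number of non-zero variables; by independence its expectation is `(1 + θ) ^
  -- S.card`.
  let F : Ω → ℝ≥0∞ := fun ω => ∏ t ∈ S, if ξ t ω ≠ 0 then (2 : ℝ≥0∞) else 1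
  have hFm : Measurable F :=
    Finset.measurable_prod _ fun t _ => (measurable_ite_ne_zero _ _).comp (hm t)
  have hF : ∫⁻ ω, F ω ∂P = ENNReal.ofReal ((1 + θ) ^ S.card) := by
    have hind' : iIndepFun (fun t ω => if ξ t ω ≠ 0 then (2 : ℝ≥0∞) else 1) P :=
      hind.comp (fun _ x => if x ≠ 0 then (2 : ℝ≥0∞) else 1) fun _ => measurable_ite_ne_zero _ _
    have := lintegral_prod_eq_prod_lintegral_of_indepFun S _ hind'
      fun t => (measurable_ite_ne_zero _ _).comp (hm t)
    rw [this, ENNReal.ofReal_pow (by linarith), Finset.prod_congr rfl fun t _ => ?_,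
      Finset.prod_const]
    rw [← lintegral_map (f := fun x : ℝ => if x ≠ 0 then (2 : ℝ≥0∞) else 1)
      (measurable_ite_ne_zero _ _) (hm t), hlaw, lintegral_sparseSign]
    simp only [ne_eq, not_true_eq_false, if_false, one_ne_zero, not_false_eq_true, if_true,
      neg_eq_zero, mul_one]
    rw [show (2 : ℝ≥0∞) + 2 = ENNReal.ofReal 4 by norm_num, ← ENNReal.ofReal_mul (by linarith),
      ← ENNReal.ofReal_add (by linarith) (by linarith)]
    congr 1; ring
  have hpt : ∀ ω, ENNReal.ofReal ((∑ t ∈ S, if ξ t ω ≠ 0 then (1 : ℝ) else 0) ^ s)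
      ≤ ENNReal.ofReal (2 * s ^ s) * (F ω - 1) := by
    intro ω
    have hN : (∑ t ∈ S, if ξ t ω ≠ 0 then (1 : ℝ) else 0)
        = ((S.filter fun t => ξ t ω ≠ 0).card : ℝ) := by
      rw [Finset.sum_ite]; simp
    have hFN : F ω = ENNReal.ofReal (2 ^ (S.filter fun t => ξ t ω ≠ 0).card) := by
      rw [ENNReal.ofReal_pow (by norm_num), ENNReal.ofReal_ofNat, ← Finset.prod_const,
        Finset.prod_filter]
    rw [hN, hFN, ← ENNReal.ofReal_one, ← ENNReal.ofReal_sub _ (by norm_num),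
      ← ENNReal.ofReal_mul hA]
    exact ENNReal.ofReal_le_ofReal (rpow_le_two_pow_sub_one hs _)
  have hF1 : ∀ ω, 1 ≤ F ω := fun ω => Finset.one_le_prod'' fun t => by
    split_ifs <;> norm_num
  calc _ ≤ ∫⁻ ω, ENNReal.ofReal (2 * s ^ s) * (F ω - 1) ∂P := lintegral_mono hpt
    _ = ENNReal.ofReal (2 * s ^ s) * (ENNReal.ofReal ((1 + θ) ^ S.card) - 1) := by
        rw [lintegral_const_mul _ (f := fun ω => F ω - 1) (hFm.sub measurable_const),
          lintegral_sub measurable_const (by simp) (Filter.Eventually.of_forall hF1), hF]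
        simp
    _ ≤ _ := by
        rw [← ENNReal.ofReal_one, ← ENNReal.ofReal_sub _ (by norm_num), ← ENNReal.ofReal_mul hA]
        refine ENNReal.ofReal_le_ofReal (mul_le_mul_of_nonneg_left ?_ hA)
        set x : ℝ := S.card * θ with hx
        -- The aim is `(1 + θ)^card - 1 ≤ exp x - 1 ≤ x * exp x`, which keeps the factor `x`.
        have e1 : (1 + θ) ^ S.card ≤ Real.exp x := by
          rw [hx, Real.exp_nat_mul]
          exact pow_le_pow_left₀ (by linarith) (by linarith [Real.add_one_le_exp θ]) _
        have e2 : 1 - x ≤ Real.exp (-x) := by linarith [Real.add_one_le_exp (-x)]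
        have e3 : Real.exp (-x) * Real.exp x = 1 := by rw [← Real.exp_add]; simp
        nlinarith [Real.exp_pos x]

end Count

/-! ### Trivial processes -/

section Trivial

variable {Ω : Type} [mΩ : MeasurableSpace Ω] {P : Measure Ω} [IsProbabilityMeasure P]

/-- An empty vector is constant, hence independent of every σ-algebra, so any filtration is allowed.
-/
lemma isBrownianMotion_dim_zero (ℱ : Filtration I mΩ) (W : Fin 0 → I → Ω → ℝ) :
    IsBrownianMotion P ℱ W where
  adapted := fun r => r.elim0
  start := fun r => r.elim0
  continuous_paths := fun r => r.elim0
  law_increment := fun s t _ => by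
    rw [Measure.pi_of_empty]
    exact hasLaw_dirac_of_ae_eq (Filter.Eventually.of_forall fun ω => Subsingleton.elim _ _)
  indep_increment := fun s t _ => by
    have : (fun (ω : Ω) (r : Fin 0) => W r t ω - W r s ω) = fun _ => 0 :=
      funext fun _ => Subsingleton.elim _ _
    rw [this, MeasurableSpace.comap_const]
    exact indep_bot_left _

lemma isItoIntegral_zero {q : ℕ} (ℱ : Filtration I mΩ) (W : Fin q → I → Ω → ℝ) :
    IsItoIntegral P ℱ W (fun _ _ _ => 0) (fun _ _ => 0) := by
  refine ⟨Filter.Eventually.of_forall fun _ => continuous_const, fun _ =>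
    { size := 0
      time := fun _ => 0
      coeff := fun _ _ _ => 0
      monotone_time := monotone_const
      measurable_coeff := fun _ _ => measurable_const
      bounded_coeff := ⟨0, fun _ _ _ => by simp⟩ }, ?_, fun t => ?_⟩
  · simp [SimpleIntegrand.process]
  · simp [SimpleIntegrand.integral]

lemma poissonMeasure_zero : poissonMeasure 0 = Measure.dirac 0 := by
  ext s hs
  rw [← (poissonMeasure 0).tsum_indicator_apply_singleton s hs,
    tsum_eq_single 0 fun k hk => by simp [Set.indicator, poissonMeasure_singleton, hk]]
  simp [Set.indicator, poissonMeasure_singleton]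

lemma isPoissonProcess_zero (ℱ : Filtration I mΩ) :
    IsPoissonProcess P ℱ (fun _ => 0) (fun _ _ => 0) where
  measurable_intensity := measurable_const
  intensity_nonneg := fun _ => le_rfl
  adapted := fun t => measurable_const
  start := Filter.Eventually.of_forall fun _ => rfl
  monotone_paths := Filter.Eventually.of_forall fun _ => monotone_const
  rightContinuous_paths := Filter.Eventually.of_forall fun _ _ => continuousWithinAt_const
  law_increment := fun s t _ => by
    rw [integral_zero, Real.toNNReal_zero, poissonMeasure_zero]
    exact hasLaw_dirac_of_ae_eq (Filter.Eventually.of_forall fun ω => rfl)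
  indep_increment := fun s t _ => by
    rw [MeasurableSpace.comap_const]
    exact indep_bot_left _

end Trivial

/-! ### Models in which the noise carries all the information -/

/-- The equidistant sampling times `k / n`. -/
def gridTime (n k : ℕ) : I := Set.projIcc 0 1 zero_le_one ((k : ℝ) / n)

lemma coe_gridTime {n k : ℕ} (hk : k ≤ n) : (gridTime n k : ℝ) = (k : ℝ) / n := by
  rw [gridTime, Set.projIcc_of_mem zero_le_one (div_mem_Icc_zero_one hk)]

lemma gridTime_lt {n k : ℕ} (hk : k < n) : gridTime n k < gridTime n (k + 1) := by
  have hn : (0 : ℝ) < n := by exact_mod_cast (by omega : 0 < n)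
  rw [← Subtype.coe_lt_coe, coe_gridTime hk.le, coe_gridTime hk]
  gcongr
  exact lt_add_one k

lemma gridTime_injOn (n : ℕ) : Set.InjOn (gridTime n) (Set.Iic n) := by
  intro k hk l hl h
  rcases Nat.eq_zero_or_pos n with rfl | hn
  · rw [Nat.le_zero.1 hk, Nat.le_zero.1 hl]
  have h' := congrArg (Subtype.val : I → ℝ) h
  rw [coe_gridTime hk, coe_gridTime hl,
    div_left_inj' (by exact_mod_cast hn.ne')] at h'
  exact_mod_cast h'

/-- The model with prices identically zero, equidistant synchronous observations, and the noise
`M_h ξ_t` in the observation of asset `h` at time `t`. It belongs to the jump-diffusion class with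
vanishing volatilities and intensities, so that the target is the noise part `ρ` alone. -/
def noiseModel {p : ℕ} (n : ℕ) {Ω : Type} [mΩ : MeasurableSpace Ω] (P : Measure Ω)
    [hP : IsProbabilityMeasure P] (ξ : I → Ω → ℝ) (M : Fin p → ℝ) (θ : ℝ) :
    MarketModel p n where
  Ω := Ω
  mΩ := mΩ
  P := P
  prob := hP
  ℱ := Filtration.const I mΩ le_rfl
  q := 0
  W := fun _ _ _ => 0
  drift := fun _ _ _ => 0
  vol := fun _ _ _ _ => 0
  jumpSize := fun _ _ _ => 0
  intensity := fun _ _ => 0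
  poisson := fun _ _ _ => 0
  Xc := fun _ _ _ => 0
  X := fun _ _ _ => 0
  noise := fun h t ω => M h * ξ t ω
  -- The same `ξ` drives all assets, and `E[ξ_t²] = θ`.
  η := fun h h' => M h * M h' * θ
  numObs := fun _ => n
  obsTime := fun _ l _ => gridTime n l
  τ := fun k _ => gridTime n k
  selTime := fun _ k _ => gridTime n k

section NoiseModel

variable {p n : ℕ} {Ω : Type} [mΩ : MeasurableSpace Ω] {P : Measure Ω} [IsProbabilityMeasure P]
  {ξ : I → Ω → ℝ} {θ : ℝ} (M : Fin p → ℝ)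

lemma noiseModel_isJumpDiffusion [hc : P.IsComplete] :
    (noiseModel n P ξ M θ).IsJumpDiffusion where
  -- The filtration is constantly the full σ-algebra: right-continuity is automatic, and
  -- completeness of `P` supplies the null sets.
  usual := ⟨⟨fun t s hs => (noiseModel n P ξ M θ).ℱ.rightCont.le t s hs⟩,
    fun s hs => hc.out' s hs⟩
  brownian := isBrownianMotion_dim_zero _ _
  progressive_drift := fun h => isProgressive_const _ 0
  progressive_vol := fun r h => isProgressive_const _ 0
  progressive_jumpSize := fun h => isProgressive_const _ 0
  poisson := fun h => isPoissonProcess_zero _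
  bounded_intensity := ⟨0, fun _ _ => le_rfl⟩
  adapted_Xc := fun h t => measurable_const
  adapted_X := fun h t => measurable_const
  continuous_part := fun h => by
    have hM : (fun (t : I) (_ : Ω) => (0 : ℝ) - 0 - ∫ _s in Set.Iic t, (0 : ℝ))
        = fun _ _ => 0 := by
      funext t ω
      simp
    change IsItoIntegral P _ _ (fun _ _ _ => 0)
      (fun (t : I) (_ : Ω) => (0 : ℝ) - 0 - ∫ _s in Set.Iic t, (0 : ℝ))
    rw [hM]
    exact isItoIntegral_zero _ _
  jump_part := fun h => Filter.Eventually.of_forall fun ω t => by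
    simp [noiseModel, jumpIntegral]

lemma noiseModel_priceSigma : (noiseModel n P ξ M θ).priceSigma = ⊥ := by
  have h : MeasurableSpace.comap (fun _ : Ω => (0 : ℝ)) inferInstance = ⊥ :=
    MeasurableSpace.comap_const 0
  exact iSup_eq_bot.2 fun _ => iSup_eq_bot.2 fun _ => sup_eq_bot_iff.2 ⟨h, h⟩

lemma noiseModel_timeSigma : (noiseModel n P ξ M θ).timeSigma = ⊥ := by
  have h : ∀ t : I, MeasurableSpace.comap (fun _ : Ω => t) inferInstance = ⊥ :=
    fun t => MeasurableSpace.comap_const t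
  exact sup_eq_bot_iff.2 ⟨sup_eq_bot_iff.2 ⟨iSup_eq_bot.2 fun _ => h _,
    iSup_eq_bot.2 fun _ => iSup_eq_bot.2 fun _ => h _⟩,
    iSup_eq_bot.2 fun _ => iSup_eq_bot.2 fun _ => h _⟩

lemma noiseModel_isNoise (h0 : 0 ≤ θ) (h1 : θ ≤ 1) (hm : ∀ t, Measurable (ξ t))
    (hlaw : ∀ t, P.map (ξ t) = sparseSign θ) (hind : iIndepFun ξ P) :
    (noiseModel n P ξ M θ).IsNoise where
  measurable := fun h t => (hm t).const_mul (M h)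
  memLp := fun h t => by
    have hb : ∀ᵐ ω ∂P, |ξ t ω| ≤ 1 :=
      ae_of_ae_map (hm t).aemeasurable (by rw [hlaw]; exact ae_abs_le_one_sparseSign)
    exact (MemLp.of_bound (hm t).aestronglyMeasurable 1 hb).const_mul (M h)
  mean_zero := fun h t => by
    change ∫ ω, M h * ξ t ω ∂P = 0
    rw [integral_const_mul, ← integral_map (φ := ξ t) (f := fun x => x) (hm t).aemeasurable
      measurable_id.aestronglyMeasurable, hlaw, integral_sparseSign h0 h1]
    ring
  covariance := fun h h' t => by
    change ∫ ω, M h * ξ t ω * (M h' * ξ t ω) ∂P = M h * M h' * θ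
    rw [← integral_map (φ := ξ t) (f := fun x => M h * x * (M h' * x)) (hm t).aemeasurable
      (by fun_prop), hlaw, integral_sparseSign h0 h1]
    ring
  identDistrib := fun h s t =>
    (IdentDistrib.mk (hm s).aemeasurable (hm t).aemeasurable
      ((hlaw s).trans (hlaw t).symm)).comp (measurable_const_mul (M h))
  indep_times :=
    hind.comp (fun _ x h => M h * x) fun _ =>
      measurable_pi_lambda _ fun h => measurable_const_mul (M h)
  indep_price := by
    rw [noiseModel_priceSigma]
    exact indep_bot_right _
  measurable_obs := fun h l _ => (hm _).const_mul (M h)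

lemma noiseModel_isSampling (hn : 0 < n) : (noiseModel n P ξ M θ).IsSampling where
  measurable_τ := fun _ _ => measurable_const
  measurable_obsTime := fun _ _ _ => measurable_const
  measurable_selTime := fun _ _ _ => measurable_const
  τ_zero := fun _ => Subtype.ext <| by
    change (gridTime n 0 : ℝ) = 0
    rw [coe_gridTime (Nat.zero_le n)]; simp
  τ_last := fun _ => Subtype.ext <| by
    change (gridTime n n : ℝ) = 1
    rw [coe_gridTime le_rfl, div_self (by exact_mod_cast hn.ne')]
  τ_lt := fun _ _ hk => gridTime_lt hk
  obsTime_lt := fun _ _ _ hl => gridTime_lt hl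
  selTime_mem := fun _ _ _ hk => ⟨gridTime_lt hk, le_rfl⟩
  selTime_obs := fun _ _ k hk => ⟨k + 1, hk, rfl⟩
  indep := by
    rw [noiseModel_timeSigma]
    exact indep_bot_left _

lemma noiseModel_T (g : ℝ → ℝ) (K : ℕ) (h h' : Fin p) (ω : Ω) :
    (noiseModel n P ξ M θ).T g K h h' ω
      = n / (phi g K * K) * zeta g K * (M h * M h' * θ) := by
  simp [MarketModel.T, MarketModel.Γ, MarketModel.γ, MarketModel.ρ, noiseModel]

/-- If no observation is contaminated, then the pre-averaged variables vanish. -/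
lemma noiseModel_Q_eq_zero {g : ℝ → ℝ} (hg0 : g 0 = 0) (hg1 : g 1 = 0) {K : ℕ} (hK : 0 < K)
    (h h' : Fin p) {k : ℕ} (hk : k + K ≤ n) {ω : Ω}
    (hω : ∀ l ∈ Finset.Icc 1 n, M h * ξ (gridTime n l) ω = 0) :
    (noiseModel n P ξ M θ).Q g K h h' k ω = 0 := by
  have hz : preAverage g K ((noiseModel n P ξ M θ).Y h ω) k = 0 := by
    -- Only the indices `k + 1, …, k + K` remain, all of them in `1, …, n`.
    rw [preAverage_eq_sum hg0 hg1 hK]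
    refine Finset.sum_eq_zero fun l hl => ?_
    have hl' := Finset.mem_range.1 hl
    have : (noiseModel n P ξ M θ).Y h ω (k + l + 1) = 0 := by
      simpa [MarketModel.Y, noiseModel] using
        hω (k + l + 1) (Finset.mem_Icc.2 ⟨by omega, by omega⟩)
    rw [this, mul_zero]
  change _ / _ * (preAverage g K ((noiseModel n P ξ M θ).Y h ω) k * _) = 0
  rw [hz, zero_mul, mul_zero]

/-- The moments of the quadratic pre-averaged variables. -/
lemma noiseModel_moment_le {g : ℝ → ℝ} (hg0 : g 0 = 0) (hg1 : g 1 = 0) {B : ℝ} (hB0 : 0 ≤ B)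
    (hB : ∀ s ∈ Set.Icc (0 : ℝ) 1, ∀ t ∈ Set.Icc (0 : ℝ) 1, |g t - g s| ≤ B * |t - s|)
    (h0 : 0 ≤ θ) (h1 : θ ≤ 1) (hm : ∀ t, Measurable (ξ t))
    (hlaw : ∀ t, P.map (ξ t) = sparseSign θ) (hind : iIndepFun ξ P)
    {K : ℕ} (hK : 0 < K) (hφ : 0 < phi g K) (h : Fin p) {k : ℕ} (hk : k + K ≤ n)
    {α : ℝ} (hα : 1 ≤ α) :
    ∫⁻ ω : Ω, ENNReal.ofReal (|(noiseModel n P ξ M θ).Qc g K h h k ω| ^ α) ∂P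
      ≤ ENNReal.ofReal ((n / (phi g K * K) * (B / K) ^ 2 * M h ^ 2) ^ α *
          (2 * (2 * α) ^ (2 * α) * (K * θ * Real.exp (K * θ)))) := by
  have hK' : (0 : ℝ) < K := by exact_mod_cast hK
  have hKn : (K : ℝ) ≤ n := by exact_mod_cast (by omega : K ≤ n)
  set D : ℝ := n / (phi g K * K) * (B / K) ^ 2 * M h ^ 2 with hD
  have hD0 : 0 ≤ D := by positivity
  let S : Finset I := (Finset.range K).image fun l => gridTime n (k + l + 1)
  have hinj : Set.InjOn (fun l => gridTime n (k + l + 1)) (Finset.range K : Set ℕ) := by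
    intro l hl l' hl' e
    have hl := Finset.mem_range.1 (Finset.mem_coe.1 hl)
    have hl' := Finset.mem_range.1 (Finset.mem_coe.1 hl')
    have := gridTime_injOn n (Set.mem_Iic.2 (by omega)) (Set.mem_Iic.2 (by omega)) e
    omega
  have hS : S.card = K := by
    rw [Finset.card_image_of_injOn hinj, Finset.card_range]
  have hb : ∀ᵐ ω ∂P, ∀ l ∈ Finset.range K, |ξ (gridTime n (k + l + 1)) ω| ≤ 1 := by
    rw [Filter.eventually_all_finset]
    exact fun l _ => ae_of_ae_map (hm (gridTime n (k + l + 1))).aemeasurable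
      (by rw [hlaw]; exact ae_abs_le_one_sparseSign)
  have hpt : ∀ᵐ ω : Ω ∂P, ENNReal.ofReal (|(noiseModel n P ξ M θ).Qc g K h h k ω| ^ α)
      ≤ ENNReal.ofReal (D ^ α) *
        ENNReal.ofReal ((∑ t ∈ S, if ξ t ω ≠ 0 then (1 : ℝ) else 0) ^ (2 * α)) := by
    filter_upwards [hb] with ω hω
    set N : ℝ := ∑ t ∈ S, if ξ t ω ≠ 0 then (1 : ℝ) else 0 with hN
    have hN0 : 0 ≤ N := Finset.sum_nonneg fun t _ => by split_ifs <;> norm_num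
    -- A window is linear in the number `N` of contaminations, so its square raised to `α` costs the
    -- moment of order `2α` of `N`.
    have hZ : |preAverage g K ((noiseModel n P ξ M θ).Yc h ω) k| ≤ B / K * (|M h| * N) := by
      refine (abs_preAverage_le hg0 hg1 hB hK _ k).trans
        (mul_le_mul_of_nonneg_left ?_ (by positivity))
      rw [hN, Finset.sum_image hinj, Finset.mul_sum]
      refine Finset.sum_le_sum fun l hl => ?_
      have hY : (noiseModel n P ξ M θ).Yc h ω (k + l + 1)
          = M h * ξ (gridTime n (k + l + 1)) ω := by simp [MarketModel.Yc, noiseModel]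
      rw [hY, abs_mul]
      refine mul_le_mul_of_nonneg_left ?_ (abs_nonneg _)
      split_ifs with hx
      · exact hω l hl
      · simp [not_not.1 hx]
    have hQ : |(noiseModel n P ξ M θ).Qc g K h h k ω| ≤ D * N ^ 2 := by
      have hQc : (noiseModel n P ξ M θ).Qc g K h h k ω = ((n : ℝ) - K) / (phi g K * K) *
          (preAverage g K ((noiseModel n P ξ M θ).Yc h ω) k *
            preAverage g K ((noiseModel n P ξ M θ).Yc h ω) k) := rfl
      rw [hQc, abs_mul, ← sq, abs_pow, abs_div,
        abs_of_nonneg (sub_nonneg.2 hKn), abs_of_pos (mul_pos hφ hK')]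
      calc _ ≤ n / (phi g K * K) * (B / K * (|M h| * N)) ^ 2 := by
            gcongr
            linarith
        _ = D * N ^ 2 := by rw [hD, mul_pow, mul_pow, sq_abs]; ring
    rw [← ENNReal.ofReal_mul (by positivity)]
    refine ENNReal.ofReal_le_ofReal ?_
    calc _ ≤ (D * N ^ 2) ^ α := Real.rpow_le_rpow (abs_nonneg _) hQ (by linarith)
      _ = D ^ α * N ^ (2 * α) := by
          rw [Real.mul_rpow hD0 (by positivity), Real.rpow_mul hN0, Real.rpow_two]
  refine (lintegral_mono_ae hpt).trans ?_
  rw [lintegral_const_mul' _ _ ENNReal.ofReal_ne_top, ENNReal.ofReal_mul (by positivity)]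
  refine mul_le_mul_right ?_ _
  have := lintegral_count_rpow_le h0 h1 hm hlaw hind S (s := 2 * α) (by linarith)
  rwa [hS] at this

lemma noiseModel_isAdmissible [P.IsComplete] {g : ℝ → ℝ} (hg0 : g 0 = 0) (hg1 : g 1 = 0) {B : ℝ}
    (hB0 : 0 ≤ B)
    (hB : ∀ s ∈ Set.Icc (0 : ℝ) 1, ∀ t ∈ Set.Icc (0 : ℝ) 1, |g t - g s| ≤ B * |t - s|)
    (h0 : 0 ≤ θ) (h1 : θ ≤ 1) (hm : ∀ t, Measurable (ξ t))
    (hlaw : ∀ t, P.map (ξ t) = sparseSign θ) (hind : iIndepFun ξ P)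
    (hn : 0 < n) {K : ℕ} (hK : 0 < K) (hφ : 0 < phi g K)
    {α : Fin p → ℝ} (hα : ∀ h, 1 ≤ α h) {νμ νγ CΔ νQ : ℝ} (hνμ : 0 ≤ νμ) (hνγ : 0 ≤ νγ)
    (hCΔ : 1 ≤ CΔ)
    (hmom : ∀ h, (n / (phi g K * K) * (B / K) ^ 2 * M h ^ 2) ^ α h *
      (2 * (2 * α h) ^ (2 * α h) * (K * θ * Real.exp (K * θ))) ≤ νQ) :
    (noiseModel n P ξ M θ).IsAdmissible g K α νμ νγ CΔ νQ where
  jumpDiffusion := noiseModel_isJumpDiffusion M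
  noise := noiseModel_isNoise M h0 h1 hm hlaw hind
  sampling := noiseModel_isSampling M hn
  drift_le := Filter.Eventually.of_forall fun ω h t => by simpa [noiseModel] using hνμ
  vol_le := Filter.Eventually.of_forall fun ω h t => by
    simpa [noiseModel, MarketModel.γ] using hνγ
  interval_le := Filter.Eventually.of_forall fun ω k hk => by
    change (gridTime n (k + 1) : ℝ) - gridTime n k ≤ CΔ / n
    rw [coe_gridTime hk, coe_gridTime hk.le, ← sub_div]
    push_cast
    rw [add_sub_cancel_left]
    gcongr
  moment_le := fun h k hk =>
    (noiseModel_moment_le M hg0 hg1 hB0 hB h0 h1 hm hlaw hind hK hφ h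
      (by have := hk.1; have := hk.2; omega) (hα h)).trans (ENNReal.ofReal_le_ofReal (hmom h))

end NoiseModel

/-! ### The choice of the noise level -/

/-- For `θ ≤ 1/2` one has `(1 - θ)(1 + 2θ) ≥ 1`, hence `1 - θ ≥ exp (-2θ)`. The factor `2` in the
denominator absorbs this loss. -/
lemma exp_neg_le_one_sub_pow {x : ℝ} {n : ℕ} (hn : 0 < n) (hx0 : 0 ≤ x) (hxn : x ≤ n) :
    Real.exp (-x) ≤ (1 - x / (2 * n)) ^ n := by
  have hn' : (0 : ℝ) < n := by exact_mod_cast hn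
  set θ : ℝ := x / (2 * n) with hθ
  have hθ0 : 0 ≤ θ := by positivity
  have hθ1 : θ ≤ 1 / 2 := by
    rw [hθ, div_le_div_iff₀ (by positivity) (by norm_num)]; linarith
  have key : Real.exp (-(2 * θ)) ≤ 1 - θ := by
    have h1 := Real.add_one_le_exp (2 * θ)
    have h2 : Real.exp (-(2 * θ)) * Real.exp (2 * θ) = 1 := by rw [← Real.exp_add]; simp
    have h3 := Real.exp_pos (-(2 * θ))
    have h4 : 1 ≤ (1 - θ) * (1 + 2 * θ) := by nlinarith
    have h5 : Real.exp (-(2 * θ)) * (1 + 2 * θ) ≤ 1 := by nlinarith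
    nlinarith
  calc Real.exp (-x) = Real.exp (-(2 * θ)) ^ n := by
        rw [← Real.exp_nat_mul, hθ]; congr 1; field_simp
    _ ≤ _ := pow_le_pow_left₀ (Real.exp_pos _).le key n

lemma jointIndex_eq {a b : ℝ} (h : jointIndex a b < 2) :
    jointIndex a b = 2 * a * b / (a + b) := by
  rcases min_choice (2 : ℝ) (2 * a * b / (a + b)) with h' | h'
  · exact absurd h' h.ne
  · exact h'

/-- The scale of the noise that exhausts a bound `νQ` on the moment of order `α`, when the
contamination rate of a pre-averaging window is of order `r`. -/
def noiseScale (s α r x : ℝ) : ℝ := √s * √x * r ^ (-(1 / (2 * α)))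

lemma noiseScale_sq {s α r x : ℝ} (hs : 0 ≤ s) (hr : 0 < r) (hx : 0 ≤ x) :
    noiseScale s α r x ^ 2 = s * x * r ^ (-(1 / α)) := by
  rw [noiseScale, mul_pow, mul_pow, Real.sq_sqrt hs, Real.sq_sqrt hx, ← Real.rpow_mul_natCast hr.le]
  congr 2
  by_cases h : α = 0
  · simp [h]
  · push_cast; field_simp

/-- When the minimum in the joint index is not `2`, its reciprocal is `1/(2a) + 1/(2b)`. The factor
`r / (2x)` is the contamination probability, so the product is `η_ij`. -/
lemma noiseScale_mul {s s' a b r x : ℝ} (ha : 1 ≤ a) (hb : 1 ≤ b)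
    (hab : jointIndex a b < 2) (hr : 0 < r) (hx : 0 < x) :
    noiseScale s a r x * noiseScale s' b r x * (r / (2 * x))
      = √s * √s' / 2 * r ^ ((jointIndex a b - 1) / jointIndex a b) := by
  have e : (jointIndex a b - 1) / jointIndex a b = -(1 / (2 * a)) + -(1 / (2 * b)) + 1 := by
    rw [jointIndex_eq hab]
    field_simp
    ring
  rw [e, Real.rpow_add hr, Real.rpow_add hr, Real.rpow_one, noiseScale, noiseScale]
  have hx2 : √x * √x = x := Real.mul_self_sqrt hx.le
  calc _ = √s * √s' / 2 * (r ^ (-(1 / (2 * a))) * r ^ (-(1 / (2 * b))) * r)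
        * ((√x * √x) / x) := by field_simp
    _ = _ := by rw [hx2, div_self hx.ne', mul_one]

/-- The scale constant for which the moments of order `α` are bounded by `νQ`. -/
def scaleConst (D E νQ α : ℝ) : ℝ := (νQ / (2 * (2 * α) ^ (2 * α) * E)) ^ (1 / α) / D

lemma scaleConst_pos {D E νQ α : ℝ} (hD : 0 < D) (hE : 0 < E) (hν : 0 < νQ) (hα : 1 ≤ α) :
    0 < scaleConst D E νQ α := by
  unfold scaleConst; positivity

/-- The bound on `u * x` cancels the factor `x` of the squared scale, whose power `α` is then of
order `r⁻¹`. The count moment contributes a factor `r`, and `scaleConst` is tuned so that the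
resulting bound is exactly `νQ`. -/
lemma moment_bound {D E νQ α r x u L : ℝ} (hD : 0 < D) (hL : 0 < L) (hE : E = L * Real.exp L)
    (hν : 0 < νQ) (hα : 1 ≤ α) (hr : 0 < r) (hr1 : r ≤ 1) (hx : 0 ≤ x) (hu : 0 ≤ u)
    (hux : u * x ≤ D) {v : ℝ} (hv0 : 0 ≤ v) (hv : v ≤ L * r) :
    (u * noiseScale (scaleConst D E νQ α) α r x ^ 2) ^ α *
      (2 * (2 * α) ^ (2 * α) * (v * Real.exp v)) ≤ νQ := by
  have hE0 : 0 < E := by rw [hE]; positivity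
  have hs := scaleConst_pos hD hE0 hν hα
  set s := scaleConst D E νQ α with hsd
  set A := 2 * (2 * α) ^ (2 * α) with hA
  have hA0 : 0 < A := by positivity
  rw [noiseScale_sq hs.le hr hx]
  have h1 : u * (s * x * r ^ (-(1 / α))) ≤ D * s * r ^ (-(1 / α)) := by
    have : 0 ≤ s * r ^ (-(1 / α)) := by positivity
    nlinarith
  have h2 : (u * (s * x * r ^ (-(1 / α)))) ^ α ≤ νQ / (A * E) * r⁻¹ := by
    refine (Real.rpow_le_rpow (by positivity) h1 (by linarith)).trans_eq ?_
    rw [Real.mul_rpow (by positivity) (by positivity), ← Real.rpow_mul hr.le,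
      show D * s = (νQ / (A * E)) ^ (1 / α) by
        rw [hsd, scaleConst, ← hA, mul_div_cancel₀ _ hD.ne'],
      ← Real.rpow_mul (by positivity), neg_mul, one_div_mul_cancel (by linarith), Real.rpow_one,
      Real.rpow_neg_one]
  have h3 : v * Real.exp v ≤ E * r := by
    have hvL : v ≤ L := hv.trans (mul_le_of_le_one_right hL.le hr1)
    calc v * Real.exp v ≤ (L * r) * Real.exp L :=
          mul_le_mul hv (Real.exp_le_exp.2 hvL) (Real.exp_pos _).le (by positivity)
      _ = E * r := by rw [hE]; ring
  calc _ ≤ νQ / (A * E) * r⁻¹ * (A * (E * r)) := by gcongr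
    _ = νQ := by field_simp

/-! ### Bounds on the pre-averaging coefficients, with `x = √n` -/

section Coefficients

variable {g : ℝ → ℝ} {K : ℕ}

lemma le_phi (hg : ContinuousOn g (Set.Icc 0 1)) {B : ℝ} (hB0 : 0 ≤ B)
    (hB : ∀ s ∈ Set.Icc (0 : ℝ) 1, ∀ t ∈ Set.Icc (0 : ℝ) 1, |g t - g s| ≤ B * |t - s|)
    (hK : 0 < K) {φ₀ : ℝ} (hφ₀ : 0 ≤ φ₀) (hint : 4 * φ₀ ≤ ∫ t in (0 : ℝ)..1, g t ^ 2)
    (hBK : B / K ≤ √φ₀) : φ₀ ≤ phi g K := by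
  have h := integral_sq_le_phi hg hB0 hB hK
  have h' : (B / K) ^ 2 ≤ φ₀ :=
    (pow_le_pow_left₀ (by positivity) hBK 2).trans_eq (Real.sq_sqrt hφ₀)
  linarith

lemma quad_coeff_le {B CK x φ₀ : ℝ} (hφ₀ : 0 < φ₀) (hCK : 0 < CK) (hx : 0 < x)
    (hφ : φ₀ ≤ phi g K) (hK : CK * x / 2 ≤ K) :
    x ^ 2 / (phi g K * K) * (B / K) ^ 2 * x ≤ 8 * B ^ 2 / (φ₀ * CK ^ 3) := by
  have hpos : 0 < CK * x / 2 := by positivity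
  have hφ' : 0 < phi g K := hφ₀.trans_le hφ
  have hK' : (0 : ℝ) < K := hpos.trans_le hK
  calc x ^ 2 / (phi g K * K) * (B / K) ^ 2 * x
      = B ^ 2 * x ^ 3 / (phi g K * K ^ 3) := by field_simp
    _ ≤ B ^ 2 * x ^ 3 / (φ₀ * (CK * x / 2) ^ 3) := by gcongr
    _ = 8 * B ^ 2 / (φ₀ * CK ^ 3) := by field_simp; ring

/-- The discrete Poincaré inequality gives `ζ ≥ φ / K`, so the coefficient of `η_ij` is at least `n
/ K²` and does not degenerate. -/
lemma le_target_coeff (h0 : g 0 = 0) {CK x : ℝ} (hCK : 0 < CK) (hx : 0 < x) (hK : 0 < K)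
    (hKx : (K : ℝ) ≤ (CK + 1) * x) (hφ : 0 < phi g K) :
    1 / (CK + 1) ^ 2 ≤ x ^ 2 / (phi g K * K) * zeta g K := by
  have hK' : (0 : ℝ) < K := by exact_mod_cast hK
  have hζ := phi_le_mul_zeta h0 K
  calc 1 / (CK + 1) ^ 2 = x ^ 2 / ((CK + 1) * x) ^ 2 := by field_simp
    _ ≤ x ^ 2 / (K : ℝ) ^ 2 := by gcongr
    _ = x ^ 2 / (phi g K * K) * (phi g K / K) := by field_simp
    _ ≤ _ := by
        gcongr
        rwa [div_le_iff₀' hK']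

end Coefficients

/-! ### Comparison of two models -/

/-- An estimator cannot be accurate both without noise and with a noise that contaminates no
observation. -/
lemma exists_noiseModel_error_ge {p n : ℕ} {Ω : Type} [MeasurableSpace Ω] {P : Measure Ω}
    [IsProbabilityMeasure P] {ξ : I → Ω → ℝ} {θ : ℝ} (hθ1 : θ ≤ 1) (hm : ∀ t, Measurable (ξ t))
    (hlaw : ∀ t, P.map (ξ t) = sparseSign θ) (hind : iIndepFun ξ P)
    {g : ℝ → ℝ} (hg0 : g 0 = 0) (hg1 : g 1 = 0) {K : ℕ} (hK : 0 < K)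
    (i j : Fin p) (That : (Fin (n - K) → ℝ) → ℝ) (M : Fin p → ℝ) {ε δ : ℝ}
    (hT : 2 * ε ≤ n / (phi g K * K) * zeta g K * (M i * M j * θ))
    (hδ1 : δ ≤ 1) (hδ : δ ≤ (1 - θ) ^ n) :
    ∃ M' : Fin p → ℝ, (M' = 0 ∨ M' = M) ∧
      ENNReal.ofReal δ ≤ P {ω | ε ≤ |That (fun k => (noiseModel n P ξ M' θ).Q g K i j (k + 1) ω)
        - (noiseModel n P ξ M' θ).T g K i j ω|} := by
  have herr : ∀ (M' : Fin p → ℝ) (ω : Ω),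
      (∀ l ∈ Finset.Icc 1 n, M' i * ξ (gridTime n l) ω = 0) →
      |That (fun k => (noiseModel n P ξ M' θ).Q g K i j (k + 1) ω)
        - (noiseModel n P ξ M' θ).T g K i j ω|
      = |That (fun _ => 0) - n / (phi g K * K) * zeta g K * (M' i * M' j * θ)| := by
    intro M' ω hω
    have hQ : (fun k : Fin (n - K) => (noiseModel n P ξ M' θ).Q g K i j (k + 1) ω)
        = fun _ => 0 := funext fun k =>
      noiseModel_Q_eq_zero M' hg0 hg1 hK i j (by have := k.2; omega) hω
    rw [hQ, noiseModel_T]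
  -- If the estimate at zero data is at least `ε` in size, the model without noise errs surely.
  -- Otherwise it misses the target `≥ 2ε` of the noisy model whenever no observation is
  -- contaminated.
  rcases le_or_gt ε |That fun _ => 0| with h | h
  · refine ⟨0, Or.inl rfl, ?_⟩
    have hset : (Set.univ : Set Ω) ⊆
        {ω | ε ≤ |That (fun k => (noiseModel n P ξ (0 : Fin p → ℝ) θ).Q g K i j (k + 1) ω)
          - (noiseModel n P ξ (0 : Fin p → ℝ) θ).T g K i j ω|} := by
      intro ω _
      change ε ≤ |_|
      rw [herr 0 ω fun l _ => zero_mul _]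
      simpa using h
    refine le_trans ?_ (measure_mono hset)
    rw [measure_univ, ← ENNReal.ofReal_one]
    exact ENNReal.ofReal_le_ofReal hδ1
  · refine ⟨M, Or.inr rfl, ?_⟩
    classical
    have hsub : {ω : Ω | ∀ t ∈ (Finset.Icc 1 n).image (gridTime n), ξ t ω = 0} ⊆
        {ω : Ω | ε ≤ |That (fun k => (noiseModel n P ξ M θ).Q g K i j (k + 1) ω)
            - (noiseModel n P ξ M θ).T g K i j ω|} := by
      intro ω hω
      change ε ≤ |_|
      rw [herr M ω fun l hl => by rw [hω _ (Finset.mem_image_of_mem _ hl), mul_zero],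
        abs_sub_comm]
      have h1 := abs_sub_abs_le_abs_sub
        (n / (phi g K * K) * zeta g K * (M i * M j * θ)) (That fun _ => 0)
      have h2 := le_abs_self (n / (phi g K * K) * zeta g K * (M i * M j * θ))
      linarith
    refine le_trans ?_ (measure_mono hsub)
    rw [measure_forall_eq_zero hm hlaw hind,
      Finset.card_image_of_injOn ((gridTime_injOn n).mono fun l hl =>
        (Finset.mem_Icc.1 (Finset.mem_coe.1 hl)).2),
      Nat.card_Icc, Nat.add_sub_cancel, ← ENNReal.ofReal_pow (by linarith)]
    exact ENNReal.ofReal_le_ofReal hδ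

end PreAveraging

end

/-! ### Choice of the constants and conclusion -/

theorem theorem4p2
    (g : ℝ → ℝ) (hg : PreAveraging.IsWeight g)
    (CK : ℝ) (hCK : 0 < CK)
    (a b : ℝ) (ha : 1 ≤ a) (hb : 1 ≤ b)
    (hab : PreAveraging.jointIndex a b ∈ Set.Ioo (1 : ℝ) 2)
    (c νμ νγ CΔ νQ : ℝ) (hc : 0 < c) (hνμ : 0 < νμ) (hνγ : 0 < νγ) (hCΔ : 1 ≤ CΔ)
    (hνQ : 0 < νQ) :
    ∃ C : ℝ, 0 < C ∧ ∃ n₀ : ℕ, ∀ n : ℕ, n₀ ≤ n →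
      ∀ K : ℕ, |(K : ℝ) - CK * Real.sqrt n| ≤ 1 →
      ∀ δ : ℝ, 0 < δ → δ⁻¹ ∈ Set.Icc ((n : ℝ) ^ c) (Real.exp (Real.sqrt n)) →
      ∀ (p : ℕ) (α : Fin p → ℝ), (∀ h, 1 ≤ α h) →
      ∀ i j : Fin p, α i = a → α j = b →
      ∀ That : (Fin (n - K) → ℝ) → ℝ, Measurable That →
      ∃ m : PreAveraging.MarketModel p n, m.IsAdmissible g K α νμ νγ CΔ νQ ∧
        ENNReal.ofReal δ ≤ m.P {ω |
          C * ((n : ℝ) ^ (-(1 / 2) : ℝ) * Real.log δ⁻¹) ^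
              ((PreAveraging.jointIndex a b - 1) / PreAveraging.jointIndex a b)
            ≤ |That (fun k => m.Q g K i j (k + 1) ω) - m.T g K i j ω|} := by
  obtain ⟨B, hB0, hB⟩ := hg.exists_lipschitz
  have hint := hg.integral_sq_pos
  obtain ⟨φ₀, hφ₀⟩ : ∃ φ₀ : ℝ, φ₀ = (∫ t in (0 : ℝ)..1, g t ^ 2) / 4 := ⟨_, rfl⟩
  have hφ₀pos : 0 < φ₀ := by rw [hφ₀]; positivity
  -- Chosen so that `K * θ ≤ L * r`, from `K ≤ (CK + 1) * x` and `θ = r / (2 * x)`.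
  obtain ⟨L, hL⟩ : ∃ L : ℝ, L = (CK + 1) / 2 := ⟨_, rfl⟩
  have hLpos : 0 < L := by rw [hL]; positivity
  obtain ⟨E, hE⟩ : ∃ E : ℝ, E = L * Real.exp L := ⟨_, rfl⟩
  have hEpos : 0 < E := by rw [hE]; positivity
  obtain ⟨D, hD⟩ : ∃ D : ℝ, D = 8 * B ^ 2 / (φ₀ * CK ^ 3) := ⟨_, rfl⟩
  have hDpos : 0 < D := by rw [hD]; positivity
  have hsa := PreAveraging.scaleConst_pos hDpos hEpos hνQ ha
  have hsb := PreAveraging.scaleConst_pos hDpos hEpos hνQ hb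
  obtain ⟨κ, hκ⟩ : ∃ κ : ℝ, κ = √(PreAveraging.scaleConst D E νQ a) *
    √(PreAveraging.scaleConst D E νQ b) / 2 := ⟨_, rfl⟩
  have hκpos : 0 < κ := by rw [hκ]; positivity
  -- The three summands ensure in turn `x ≥ 2`, `CK * x ≥ 2` (so `K` is comparable to `x`), and `B /
  -- K ≤ √φ₀`.
  obtain ⟨R, hR⟩ : ∃ R : ℝ, R = 2 + 2 / CK + 2 * B / (CK * √φ₀) := ⟨_, rfl⟩
  refine ⟨κ / (2 * (CK + 1) ^ 2), by positivity, ⌈R ^ 2⌉₊, ?_⟩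
  intro n hn K hKn δ hδ hδn p α hα i j hi hj That _
  -- the sizes of `n` and `K`
  obtain ⟨x, hx⟩ : ∃ x : ℝ, x = √(n : ℝ) := ⟨_, rfl⟩
  rw [← hx] at hKn hδn
  have hRx : R ≤ x := by
    rw [hx]
    exact Real.le_sqrt_of_sq_le ((Nat.le_ceil _).trans (by exact_mod_cast hn))
  have hterm1 : 0 < 2 / CK := by positivity
  have hterm2 : 0 < 2 * B / (CK * √φ₀) := by positivity
  have hx2 : 2 ≤ x := by linarith
  have hxpos : 0 < x := by linarith
  have hxx : x ^ 2 = n := by rw [hx]; exact Real.sq_sqrt (Nat.cast_nonneg n)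
  have hnx : x ≤ n := by nlinarith
  have hn1 : (1 : ℝ) < n := by nlinarith
  have hnpos : 0 < n := by exact_mod_cast zero_lt_one.trans hn1
  have hCKx : 2 ≤ CK * x := by
    have h : 2 / CK ≤ x := by linarith
    rw [div_le_iff₀ hCK] at h; linarith
  have hKlow : CK * x / 2 ≤ K := by linarith [(abs_le.1 hKn).1]
  have hKup : (K : ℝ) ≤ (CK + 1) * x := by linarith [(abs_le.1 hKn).2]
  have hK' : (0 : ℝ) < K := by linarith
  have hK : 0 < K := by exact_mod_cast hK'
  have hφ : φ₀ ≤ PreAveraging.phi g K := by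
    have h1 : 2 * B / (CK * √φ₀) ≤ x := by linarith
    have hsq : 0 < √φ₀ := Real.sqrt_pos.2 hφ₀pos
    rw [div_le_iff₀ (by positivity)] at h1
    refine PreAveraging.le_phi hg.continuousOn hB0.le hB hK hφ₀pos.le (by linarith) ?_
    rw [div_le_iff₀ hK']
    nlinarith
  have hφpos : 0 < PreAveraging.phi g K := hφ₀pos.trans_le hφ
  -- the contamination probability
  obtain ⟨ℓ, hℓ⟩ : ∃ ℓ : ℝ, ℓ = Real.log δ⁻¹ := ⟨_, rfl⟩
  have hℓpos : 0 < ℓ := by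
    rw [hℓ]
    exact Real.log_pos ((Real.one_lt_rpow hn1 hc).trans_le hδn.1)
  -- The upper limit `exp √n` for `δ⁻¹` enters here and yields `r ≤ 1`.
  have hℓx : ℓ ≤ x := by
    rw [hℓ, ← Real.log_exp x]
    exact Real.log_le_log (by positivity) hδn.2
  have hδℓ : δ = Real.exp (-ℓ) := by rw [hℓ, Real.log_inv, neg_neg, Real.exp_log hδ]
  obtain ⟨r, hr⟩ : ∃ r : ℝ, r = ℓ / x := ⟨_, rfl⟩
  have hrpos : 0 < r := by rw [hr]; positivity
  have hr1 : r ≤ 1 := by rw [hr]; exact div_le_one_of_le₀ hℓx hxpos.le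
  have hrate : (n : ℝ) ^ (-(1 / 2) : ℝ) * Real.log δ⁻¹ = r := by
    rw [Real.rpow_neg (Nat.cast_nonneg n), ← Real.sqrt_eq_rpow, ← hx, ← hℓ, hr]
    field_simp
  -- The largest order of contamination for which a clean sample still has probability at least `exp
  -- (-ℓ) = δ`.
  obtain ⟨θ, hθ⟩ : ∃ θ : ℝ, θ = ℓ / (2 * n) := ⟨_, rfl⟩
  have hθ0 : 0 ≤ θ := by rw [hθ]; positivity
  have hθr : θ = r / (2 * x) := by
    rw [hθ, hr, ← hxx]; field_simp
  have hθ1 : θ ≤ 1 := by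
    rw [hθ]; exact div_le_one_of_le₀ (by linarith) (by positivity)
  have hKθ : K * θ ≤ L * r := by
    rw [hθr, hL]
    calc (K : ℝ) * (r / (2 * x)) ≤ (CK + 1) * x * (r / (2 * x)) := by gcongr
      _ = (CK + 1) / 2 * r := by field_simp
  have hux : n / (PreAveraging.phi g K * K) * (B / K) ^ 2 * x ≤ D := by
    rw [hD, ← hxx]
    exact PreAveraging.quad_coeff_le hφ₀pos hCK hxpos hφ hKlow
  have := PreAveraging.isProbabilityMeasure_sparseSign hθ0 hθ1
  obtain ⟨Ω, mΩ, P, ξ, hP, hPc, hm, hlaw, hind⟩ :=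
    PreAveraging.exists_iid_isComplete I (PreAveraging.sparseSign θ)
  have hadm : ∀ M : Fin p → ℝ, (∀ h, M h = 0 ∨
      M h = PreAveraging.noiseScale (PreAveraging.scaleConst D E νQ (α h)) (α h) r x) →
      (PreAveraging.noiseModel n P ξ M θ).IsAdmissible g K α νμ νγ CΔ νQ := by
    intro M hM
    refine PreAveraging.noiseModel_isAdmissible M hg.zero hg.one hB0.le hB hθ0 hθ1 hm hlaw hind
      hnpos hK hφpos hα hνμ.le hνγ.le hCΔ fun h => ?_
    rcases hM h with h0 | h0
    · rw [h0, zero_pow two_ne_zero, mul_zero, Real.zero_rpow (by linarith [hα h]), zero_mul]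
      exact hνQ.le
    · rw [h0]
      exact PreAveraging.moment_bound hDpos hLpos hE hνQ (hα h) hrpos hr1 hxpos.le (by positivity)
        hux (by positivity) hKθ
  rw [hrate]
  set ρ : ℝ := r ^ ((PreAveraging.jointIndex a b - 1) / PreAveraging.jointIndex a b) with hρ
  have hρpos : 0 < ρ := Real.rpow_pos_of_pos hrpos _
  classical
  let M : Fin p → ℝ := fun h => if h = i ∨ h = j then
    PreAveraging.noiseScale (PreAveraging.scaleConst D E νQ (α h)) (α h) r x else 0
  have hMM : M i * M j * θ = κ * ρ := by
    have e1 : M i = PreAveraging.noiseScale (PreAveraging.scaleConst D E νQ a) a r x := by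
      simp [M, hi]
    have e2 : M j = PreAveraging.noiseScale (PreAveraging.scaleConst D E νQ b) b r x := by
      simp [M, hj]
    rw [e1, e2, hθr, PreAveraging.noiseScale_mul ha hb hab.2 hrpos hxpos, hκ, hρ]
  -- The constant of the theorem is half the guaranteed gap between the two targets.
  have hTlow : 2 * (κ / (2 * (CK + 1) ^ 2) * ρ)
      ≤ n / (PreAveraging.phi g K * K) * PreAveraging.zeta g K * (M i * M j * θ) := by
    have hcoef := PreAveraging.le_target_coeff hg.zero hCK hxpos hK hKup hφpos
    rw [hxx] at hcoef
    rw [hMM]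
    calc 2 * (κ / (2 * (CK + 1) ^ 2) * ρ) = 1 / (CK + 1) ^ 2 * (κ * ρ) := by field_simp
      _ ≤ _ := by gcongr
  have hδ1 : δ ≤ 1 := by
    rw [hδℓ]
    exact Real.exp_le_one_iff.2 (by linarith)
  have hδθ : δ ≤ (1 - θ) ^ n := by
    rw [hδℓ, hθ]
    exact PreAveraging.exp_neg_le_one_sub_pow hnpos hℓpos.le (hℓx.trans hnx)
  obtain ⟨M', hM', hprob⟩ := PreAveraging.exists_noiseModel_error_ge hθ1 hm hlaw hind
    hg.zero hg.one hK i j That M hTlow hδ1 hδθ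
  refine ⟨PreAveraging.noiseModel n P ξ M' θ, hadm M' fun h => ?_, hprob⟩
  rcases hM' with rfl | rfl
  · exact Or.inl rfl
  · by_cases h' : h = i ∨ h = j
    · exact Or.inr (if_pos h')
    · exact Or.inl (if_neg h')
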